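/- For $\rho\in\mathbb R$ and a nonnegative Borel measure $\mu$ on $[0,\infty)$ put $$\|\mu\|_\rho=\sup_{R>1}\frac{1}{(1+R)^\rho}\,\frac1R\,\mu([R/2,R])+\mu([0,1]),\qquad \mathcal M_+^\rho=\{\mu\ge 0:\ \|\mu\|_\rho<\infty\}.$$ Let $f_0$ be a nonnegative measure on $(0,\infty)$. A family $(g(t))_{t\ge 0}$ of nonnegative measures on $[0,\infty)$, formally $g(t,\omega)=\sqrt\omega f(t,\omega)$, is called a (mass and energy conserving, nonnegative) weak solution of the radial 4-wave kinetic equation $$\partial_t f_1=\iint \frac{\min_i\sqrt{\omega_i}}{\sqrt{\omega_1}}\big[(f_1+f_2)f_3f_4-(f_3+f_4)f_1f_2\big]\,d\omega_3\,d\omega_4,\qquad \omega_2=\omega_3+\omega_4-\omega_1\geq 0,$$ with initial data $f_0$ (in the class $\mathcal M_+^\rho$) if 1. $g\in C([0,\infty);\mathcal M_+^\rho)$, for the weak topology of measures (tested against continuous compactly supported functions on $[0,\infty)$); 2. for all $\varphi\in C^2_c([0,\infty)\times[0,\infty))$ and all $t_*>0$, $$\int g(t_*,d\omega)\,\varphi(t_*,\omega)-\int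 \varphi(0,\omega)\sqrt\omega\,f_0(d\omega)=\int_0^{t_*}\!\!\int g(t,d\omega)\,\partial_t\varphi(t,\omega)\,dt$$ $$+\int_0^{t_*}\!\!\iiint_{[0,\infty)^3}\frac{\Phi}{\sqrt{\omega_1\omega_2\omega_3}}\big[\varphi(t,\omega_1+\omega_2-\omega_3)+\varphi(t,\omega_3)-\varphi(t,\omega_1)-\varphi(t,\omega_2)\big]\,g(t,d\omega_1)\,g(t,d\omega_2)\,g(t,d\omega_3)\,dt,$$ where $\Phi=\min\{\sqrt{\omega_1},\sqrt{\omega_2},\sqrt{\omega_3},\sqrt{\omega_4}\}$, $\omega_4=(\omega_1+\omega_2-\omega_3)_+$, and the integrand is extended by continuity to the points where some of $\omega_1,\omega_2,\omega_3$ vanish; 3. for all $t>0$, $\int g(t,d\omega)=\int\sqrt\omega f_0(d\omega)$ and $\int \omega\, g(t,d\omega)=\int\omega\sqrt\omega f_0(d\omega)$ (in $[0,\infty]$). **Theorem.** There exists a numerical constant $C>0$ such that, for all $A>0$, $B>0$, $\rho<-1$ and all $g_0\in\mathcal M_+^\rho$, if $$f_0(\omega)=A\omega^{-1}\mathbf 1_{0<\omega<B}+\min\Big(A\omega^{-1},\frac{g_0(\omega)}{\sqrt\omega}\Big)\mathbf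 1_{\omega>B}$$ (the minimum being the infimum of the two measures $A\omega^{-1}d\omega$ and $\omega^{-1/2}g_0$, i.e. the minimum of the densities if $g_0$ has one), then every weak solution $g$ with initial data $f_0$ satisfies $$g(t,\{0\})>0\qquad\text{for all } t>CA^{-2}.$$ -/

import Mathlib

open MeasureTheory Set
open scoped ENNReal

noncomputable section

namespace WaveKinetic

/-- The quantity `‖μ‖_ρ = sup_{R > 1} (1 + R)^{-ρ} R⁻¹ μ([R/2, R]) + μ([0, 1])`, with values
in `[0, ∞]`. -/
def rhoNorm (ρ : ℝ) (μ : Measure ℝ) : ℝ≥0∞ :=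
  (⨆ R ∈ Ioi (1 : ℝ), ENNReal.ofReal (1 / (1 + R) ^ ρ * (1 / R)) * μ (Icc (R / 2) R))
    + μ (Icc 0 1)

/-- `μ ∈ 𝓜₊^ρ([0, ∞))`: a nonnegative measure carried by `[0, ∞)` with `‖μ‖_ρ < ∞`. -/
def MemMRho (ρ : ℝ) (μ : Measure ℝ) : Prop :=
  μ (Iio 0) = 0 ∧ rhoNorm ρ μ < ∞

/-- The measure `g = √ω f` attached to a measure `f` on `[0, ∞)`. -/
def sqrtMul (f : Measure ℝ) : Measure ℝ :=
  f.withDensity fun ω => ENNReal.ofReal (√ω)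

/-- The collision kernel `Φ / √(ω₁ ω₂ ω₃)`, where
`Φ = min {√ω₁, √ω₂, √ω₃, √ω₄}` and `ω₄ = (ω₁ + ω₂ - ω₃)₊` (`√` vanishes on negative numbers).
The quotient reads `0 / 0` where some `ωᵢ` vanishes; there it is given its limiting value:
`1 / √(ω₂ ω₃)` (if `ω₃ ≤ ω₂`, and `0` otherwise) on `ω₁ = 0`, symmetrically on `ω₂ = 0`, and
`1 / √(ω₁ ω₂)` on `ω₃ = 0`. With these values the product of the kernel with
`φ(ω₁ + ω₂ - ω₃) + φ(ω₃) - φ(ω₁) - φ(ω₂)`, `φ ∈ C²`, is continuous on `[0, ∞)³`; where two of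
the `ωᵢ` vanish the product is `0`, whatever the value of the kernel. -/
def kernel (ω₁ ω₂ ω₃ : ℝ) : ℝ :=
  if ω₁ = 0 then (if ω₃ ≤ ω₂ then 1 / √(ω₂ * ω₃) else 0)
  else if ω₂ = 0 then (if ω₃ ≤ ω₁ then 1 / √(ω₁ * ω₃) else 0)
  else if ω₃ = 0 then 1 / √(ω₁ * ω₂)
  else min (min (√ω₁) (√ω₂)) (min (√ω₃) (√(ω₁ + ω₂ - ω₃))) / √(ω₁ * ω₂ * ω₃)

/-- The weak collision integral of the measure `μ` against the test function `φ`. The kernel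
vanishes where `ω₁ + ω₂ - ω₃ < 0`, so only values of `φ` on `[0, ∞)` enter. -/
def collision (μ : Measure ℝ) (φ : ℝ → ℝ) : ℝ :=
  ∫ p : ℝ × ℝ × ℝ, kernel p.1 p.2.1 p.2.2 *
    (φ (p.1 + p.2.1 - p.2.2) + φ p.2.2 - φ p.1 - φ p.2.1) ∂(μ.prod (μ.prod μ))

/-- `g(t) = √ω f(t)` is (the measure attached to) a nonnegative weak solution, conserving mass
and energy, of the radial 4-wave kinetic equation with initial data `f₀`. -/
structure IsWeakSolution (ρ : ℝ) (f₀ : Measure ℝ) (g : ℝ → Measure ℝ) : Prop where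
  mem : ∀ t, 0 ≤ t → MemMRho ρ (g t)
  /-- Continuity in time for the weak topology of measures on `[0, ∞)`. -/
  cont : ∀ ψ : ℝ → ℝ, Continuous ψ → HasCompactSupport ψ →
    ContinuousOn (fun t => ∫ ω, ψ ω ∂(g t)) (Ici 0)
  /-- The weak formulation; `φ t ω` is `C²` with compact support. -/
  weak : ∀ φ : ℝ → ℝ → ℝ, ContDiff ℝ 2 (Function.uncurry φ) →
    HasCompactSupport (Function.uncurry φ) → ∀ T : ℝ, 0 < T →
      (∫ ω, φ T ω ∂(g T)) - ∫ ω, φ 0 ω ∂(sqrtMul f₀)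
        = (∫ t in (0 : ℝ)..T, ∫ ω, deriv (fun s => φ s ω) t ∂(g t))
          + ∫ t in (0 : ℝ)..T, collision (g t) (φ t)
  mass : ∀ t, 0 < t → g t univ = sqrtMul f₀ univ
  energy : ∀ t, 0 < t →
    ∫⁻ ω, ENNReal.ofReal ω ∂(g t) = ∫⁻ ω, ENNReal.ofReal ω ∂(sqrtMul f₀)

/-- The singular Rayleigh-Jeans measure `A ω⁻¹ dω` on `(0, ∞)`. -/
def rayleighJeans (A : ℝ) : Measure ℝ :=
  (volume.restrict (Ioi 0)).withDensity fun ω => ENNReal.ofReal (A * ω⁻¹)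

/-- `f₀ = A ω⁻¹ 1_{0 < ω < B} + min (A ω⁻¹, g₀ / √ω) 1_{ω > B}`. As `g₀` is a measure, the minimum
is the infimum of two measures; if `g₀ = h dω`, it is the measure with
density `min (A ω⁻¹, h(ω) / √ω)`. -/
def initialData (A B : ℝ) (g₀ : Measure ℝ) : Measure ℝ :=
  (rayleighJeans A).restrict (Ioo 0 B)
    + (rayleighJeans A ⊓ g₀.withDensity fun ω => ENNReal.ofReal (1 / √ω)).restrict (Ioi B)

end WaveKinetic

end

open MeasureTheory Set
open scoped ENNReal

noncomputable section

namespace WaveKinetic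

/-! ### The collision kernel -/

/-! Averaged over the cyclic permutations of its three frequencies, the collision integrand of a
convex function is nonnegative. Hence the truncated mass `M_r(t) = ∫ (1 - ω/r)₊³ g(t, dω)` never
decreases in time; the Rayleigh-Jeans part of the data gives `M_r ≥ N √r` for all `r ≤ B`, with `N =
A/16`.

Convexity also gives a quantitative gain (`le_collision_cubic`): a frequency below `r/16` and two in
`(r/4, r]` feed `M_r` at rate at least of order `r⁻¹ μ([0, r/16]) n²`, where `n` is the mass of the
shell `(r/4, r]`. Since `μ([0, r/16])` is at least of order `N √r`, `n²` is controlled by `√r / N`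
times the growth rate of `M_r`.

Suppose that `g(T)` has no atom at `0`. By monotonicity in time, up to time `T` at least half of
`M_r` is carried by finitely many shells `(r/4^(k+1), r/4^k]`. Summing the shell estimates with
geometric weights and integrating in time, the growth of the `M_{r/4^k}`, itself bounded by `M_r`,
forces `M_r ≥ 2N √r` after a time of order `N⁻²` (`two_mul_le_truncMass`). Iterating, the successive
times decay like `4⁻ʲ` and add up to a multiple of `N⁻²`. Past that time `M_B` would exceed every
`2ʲ N √B`, contradicting finiteness of the mass. -/

lemma kernel_nonneg (x y z : ℝ) : 0 ≤ kernel x y z := by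
  unfold kernel
  split_ifs <;> positivity

lemma kernel_comm (x y z : ℝ) : kernel x y z = kernel y x z := by
  unfold kernel
  by_cases hx : x = 0 <;> by_cases hy : y = 0
  · simp [hx, hy]
  · simp [hx, hy]
  · simp [hx, hy]
  · simp only [hx, hy, if_false]
    rw [min_comm (√x), mul_comm x y, add_comm x y]

lemma kernel_of_add_sub_neg {x y z : ℝ} (hx : 0 ≤ x) (hy : 0 ≤ y) (h : x + y - z < 0) :
    kernel x y z = 0 := by
  have hz : z ≠ 0 := by rintro rfl; linarith
  unfold kernel
  split_ifs with h1 h2 h3 h4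
  · linarith
  · rfl
  · linarith
  · rfl
  · rw [Real.sqrt_eq_zero'.mpr h.le]
    simp [Real.sqrt_nonneg]

/-- The minimum `Φ` is `√a`, which cancels the same factor of the denominator; the conventions on
the boundary agree with this value. -/
lemma kernel_of_third_min {a b c : ℝ} (ha : 0 ≤ a) (hab : a ≤ b) (hbc : b ≤ c) :
    kernel b c a = 1 / √(b * c) := by
  rcases ha.eq_or_lt with rfl | ha
  · rcases hab.eq_or_lt with rfl | hb
    · simp [kernel]
    · simp [kernel, hb.ne', (hb.trans_le hbc).ne']
  · have hb := ha.trans_le hab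
    have hc := hb.trans_le hbc
    have h1 : √a ≤ √b := Real.sqrt_le_sqrt hab
    have h2 : √a ≤ √c := Real.sqrt_le_sqrt (hab.trans hbc)
    have h3 : √a ≤ √(b + c - a) := Real.sqrt_le_sqrt (by linarith)
    have hs : 0 < √a := Real.sqrt_pos.mpr ha
    have hs' : 0 < √(b * c) := Real.sqrt_pos.mpr (by positivity)
    simp only [kernel, hb.ne', hc.ne', ha.ne', if_false]
    rw [min_eq_left h3, min_eq_right (le_min h1 h2), Real.sqrt_mul' (b * c) ha.le]
    field_simp

lemma kernel_of_third_mid {a b c : ℝ} (ha : 0 ≤ a) (hab : a ≤ b) (hbc : b ≤ c) :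
    kernel c a b = 1 / √(b * c) := by
  rcases ha.eq_or_lt with rfl | ha
  · rcases (hab.trans hbc).eq_or_lt with rfl | hc
    · obtain rfl : b = 0 := le_antisymm hbc hab
      simp [kernel]
    · simp [kernel, hc.ne', hbc, mul_comm]
  · have hb := ha.trans_le hab
    have hc := hb.trans_le hbc
    have h1 : √a ≤ √b := Real.sqrt_le_sqrt hab
    have h2 : √a ≤ √c := Real.sqrt_le_sqrt (hab.trans hbc)
    have h3 : √a ≤ √(c + a - b) := Real.sqrt_le_sqrt (by linarith)
    have hs : 0 < √a := Real.sqrt_pos.mpr ha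
    have hs' : 0 < √(b * c) := Real.sqrt_pos.mpr (by positivity)
    simp only [kernel, hb.ne', hc.ne', ha.ne', if_false]
    rw [min_eq_right h2, min_eq_left (le_min h1 h3), show c * a * b = b * c * a by ring,
      Real.sqrt_mul' (b * c) ha.le]
    field_simp

/-- Here `ω₄ = a + b - c` may be smaller than `a`, so bounding `Φ` by `√a` gives only an inequality.
-/
lemma kernel_le_of_third_max {a b c : ℝ} (ha : 0 ≤ a) (hab : a ≤ b) (hbc : b ≤ c) :
    kernel a b c ≤ 1 / √(b * c) := by
  rcases ha.eq_or_lt with rfl | ha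
  · simp only [kernel, if_true]
    split_ifs
    · exact le_rfl
    · positivity
  · have hb := ha.trans_le hab
    have hc := hb.trans_le hbc
    have hs : 0 < √a := Real.sqrt_pos.mpr ha
    have hs' : 0 < √(b * c) := Real.sqrt_pos.mpr (by positivity)
    simp only [kernel, hb.ne', hc.ne', ha.ne', if_false]
    rw [show a * b * c = a * (b * c) by ring, Real.sqrt_mul ha.le]
    calc _ ≤ √a / (√a * √(b * c)) := by
          gcongr
          exact (min_le_left _ _).trans (min_le_left _ _)
      _ = 1 / √(b * c) := by field_simp

lemma measurable_kernel : Measurable fun p : ℝ × ℝ × ℝ => kernel p.1 p.2.1 p.2.2 := by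
  have h1 : Measurable fun p : ℝ × ℝ × ℝ => p.1 := by fun_prop
  have h2 : Measurable fun p : ℝ × ℝ × ℝ => p.2.1 := by fun_prop
  have h3 : Measurable fun p : ℝ × ℝ × ℝ => p.2.2 := by fun_prop
  unfold kernel
  refine Measurable.ite (measurableSet_eq_fun h1 measurable_const)
    (Measurable.ite (measurableSet_le h3 h2) (by fun_prop) (by fun_prop)) ?_
  refine Measurable.ite (measurableSet_eq_fun h2 measurable_const)
    (Measurable.ite (measurableSet_le h3 h1) (by fun_prop) (by fun_prop)) ?_
  refine Measurable.ite (measurableSet_eq_fun h3 measurable_const) (by fun_prop) ?_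
  fun_prop

/-! ### The collision integrand -/

/-- The integrand of the weak collision integral. -/
def integrand (f : ℝ → ℝ) (x y z : ℝ) : ℝ :=
  kernel x y z * (f (x + y - z) + f z - f x - f y)

lemma integrand_comm (f : ℝ → ℝ) (x y z : ℝ) : integrand f x y z = integrand f y x z := by
  unfold integrand
  rw [kernel_comm, add_comm x y]
  ring

lemma integrand_congr {f h : ℝ → ℝ} (hfh : ∀ x, 0 ≤ x → f x = h x) {x y z : ℝ} (hx : 0 ≤ x)
    (hy : 0 ≤ y) (hz : 0 ≤ z) : integrand f x y z = integrand h x y z := by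
  unfold integrand
  by_cases hw : x + y - z < 0
  · simp [kernel_of_add_sub_neg hx hy hw]
  · rw [hfh x hx, hfh y hy, hfh z hz, hfh _ (not_lt.mp hw)]

lemma measurable_integrand {f : ℝ → ℝ} (hf : Continuous f) :
    Measurable fun p : ℝ × ℝ × ℝ => integrand f p.1 p.2.1 p.2.2 := by
  have := hf.measurable
  exact measurable_kernel.mul (by fun_prop)

lemma le_sqrt_mul_of_le {u b c : ℝ} (hu : 0 ≤ u) (hub : u ≤ b) (hbc : b ≤ c) :
    u ≤ √(b * c) :=
  Real.le_sqrt_of_sq_le (by nlinarith)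

/-- Pairing the four values of `f` in two ways gains a factor `|x - z|` or `|y - z|`; in each
ordering of `x, y, z` one of them is at most the square root in the denominator of the kernel. The
singularity at the origin thus disappears for Lipschitz `f`. -/
lemma abs_integrand_le {f : ℝ → ℝ} {L : ℝ}
    (hL : ∀ x y, 0 ≤ x → 0 ≤ y → |f x - f y| ≤ L * |x - y|) {x y z : ℝ}
    (hx : 0 ≤ x) (hy : 0 ≤ y) (hz : 0 ≤ z) : |integrand f x y z| ≤ 2 * L := by
  have hL0 : 0 ≤ L := by simpa using (abs_nonneg _).trans (hL 1 0 zero_le_one le_rfl)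
  wlog hxy : x ≤ y generalizing x y
  · rw [integrand_comm]
    exact this hy hx (le_of_not_ge hxy)
  by_cases hw : x + y - z < 0
  · simp [integrand, kernel_of_add_sub_neg hx hy hw, hL0]
  push Not at hw
  have hD1 : |f (x + y - z) + f z - f x - f y| ≤ 2 * L * |x - z| := by
    have h1 := hL _ y hw hy
    have h2 := hL z x hz hx
    rw [show x + y - z - y = x - z by ring] at h1
    rw [abs_sub_comm z x] at h2
    calc _ = |(f (x + y - z) - f y) + (f z - f x)| := by ring_nf
      _ ≤ _ := (abs_add_le _ _).trans (by linarith)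
  have hD2 : |f (x + y - z) + f z - f x - f y| ≤ 2 * L * |y - z| := by
    have h1 := hL _ x hw hx
    have h2 := hL z y hz hy
    rw [show x + y - z - x = y - z by ring] at h1
    rw [abs_sub_comm z y] at h2
    calc _ = |(f (x + y - z) - f x) + (f z - f y)| := by ring_nf
      _ ≤ _ := (abs_add_le _ _).trans (by linarith)
  have key : ∀ u s : ℝ, 0 ≤ u → u ≤ s → kernel x y z ≤ 1 / s →
      |f (x + y - z) + f z - f x - f y| ≤ 2 * L * u → |integrand f x y z| ≤ 2 * L := by
    intro u s hu hus hk hD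
    rw [integrand, abs_mul, abs_of_nonneg (kernel_nonneg x y z)]
    calc _ ≤ 1 / s * (2 * L * u) := by
          refine mul_le_mul hk hD (abs_nonneg _) ((kernel_nonneg x y z).trans hk)
      _ = 2 * L * (u / s) := by ring
      _ ≤ 2 * L * 1 := by
          gcongr
          exact div_le_one_of_le₀ hus (hu.trans hus)
      _ = 2 * L := mul_one _
  rcases le_total z x with hzx | hzx
  · exact key |x - z| √(x * y) (abs_nonneg _)
      (le_sqrt_mul_of_le (abs_nonneg _) (by rw [abs_of_nonneg] <;> linarith) hxy)
      (kernel_of_third_min hz hzx hxy).le hD1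
  · rcases le_total z y with hzy | hzy
    · exact key |x - z| √(z * y) (abs_nonneg _)
        (le_sqrt_mul_of_le (abs_nonneg _) (by rw [abs_of_nonpos] <;> linarith) hzy)
        (by rw [kernel_comm, kernel_of_third_mid hx hzx hzy]) hD1
    · exact key |y - z| √(y * z) (abs_nonneg _)
        (le_sqrt_mul_of_le (abs_nonneg _) (by rw [abs_of_nonpos] <;> linarith) hzy)
        (kernel_le_of_third_max hx hxy hzy) hD2

/-- The sum of the collision integrand over the three cyclic permutations of its arguments. -/
def symIntegrand (f : ℝ → ℝ) (x y z : ℝ) : ℝ :=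
  integrand f x y z + integrand f y z x + integrand f z x y

lemma symIntegrand_swap (f : ℝ → ℝ) (x y z : ℝ) :
    symIntegrand f x y z = symIntegrand f y x z := by
  unfold symIntegrand
  rw [integrand_comm f x y z, integrand_comm f y z x, integrand_comm f z x y]
  ring

lemma symIntegrand_rotate (f : ℝ → ℝ) (x y z : ℝ) :
    symIntegrand f x y z = symIntegrand f y z x := by
  unfold symIntegrand
  ring

lemma add_le_add_of_convexOn_of_add_eq {f : ℝ → ℝ} (hf : ConvexOn ℝ univ f) {u v x y : ℝ}
    (hux : u ≤ x) (hxv : x ≤ v) (h : x + y = u + v) : f x + f y ≤ f u + f v := by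
  rcases (hux.trans hxv).eq_or_lt with rfl | huv
  · obtain rfl : x = u := le_antisymm hxv hux
    obtain rfl : y = x := by linarith
    rfl
  · have hd : 0 < v - u := sub_pos.mpr huv
    have h1 : 0 ≤ (v - x) / (v - u) := div_nonneg (by linarith) hd.le
    have h2 : 0 ≤ (x - u) / (v - u) := div_nonneg (by linarith) hd.le
    have h3 : (v - x) / (v - u) + (x - u) / (v - u) = 1 := by field_simp; ring
    have e1 := hf.2 (mem_univ u) (mem_univ v) h1 h2 h3
    have e2 := hf.2 (mem_univ u) (mem_univ v) h2 h1 (by linarith)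
    simp only [smul_eq_mul] at e1 e2
    have hx : (v - x) / (v - u) * u + (x - u) / (v - u) * v = x := by field_simp; ring
    have hy : (x - u) / (v - u) * u + (v - x) / (v - u) * v = y := by
      obtain rfl : y = u + v - x := by linarith
      field_simp; ring
    rw [hx] at e1
    rw [hy] at e2
    have : f x + f y ≤ ((v - x) / (v - u) + (x - u) / (v - u)) * (f u + f v) := by linarith
    rwa [h3, one_mul] at this

/-- The term with output `c` is nonnegative, since the pair `(a + b - c, c)` is more spread out than
`(a, b)`. The other two terms share the kernel `1 / √(b c)`, and their sum telescopes to a second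
difference of `f` at `c` with step `b - a`. -/
lemma le_symIntegrand_of_sorted {f : ℝ → ℝ} (hf : ConvexOn ℝ univ f) {a b c : ℝ}
    (ha : 0 ≤ a) (hab : a ≤ b) (hbc : b ≤ c) :
    1 / √(b * c) * (f (c + (b - a)) + f (c - (b - a)) - 2 * f c) ≤ symIntegrand f a b c := by
  have h1 : 0 ≤ integrand f a b c := by
    refine mul_nonneg (kernel_nonneg _ _ _) ?_
    have := add_le_add_of_convexOn_of_add_eq hf (u := a + b - c) (v := c) (x := a) (y := b)
      (by linarith) (hab.trans hbc) (by ring)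
    linarith
  have h2 : integrand f b c a + integrand f c a b
      = 1 / √(b * c) * (f (c + (b - a)) + f (c - (b - a)) - 2 * f c) := by
    rw [integrand, integrand, kernel_of_third_min ha hab hbc, kernel_of_third_mid ha hab hbc,
      show b + c - a = c + (b - a) by ring, show c + a - b = c - (b - a) by ring]
    ring
  rw [symIntegrand]
  linarith

lemma symIntegrand_nonneg {f : ℝ → ℝ} (hf : ConvexOn ℝ univ f) {x y z : ℝ}
    (hx : 0 ≤ x) (hy : 0 ≤ y) (hz : 0 ≤ z) : 0 ≤ symIntegrand f x y z := by
  have key : ∀ {a b c : ℝ}, 0 ≤ a → a ≤ b → b ≤ c → 0 ≤ symIntegrand f a b c := by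
    intro a b c ha hab hbc
    refine le_trans (mul_nonneg (by positivity) ?_) (le_symIntegrand_of_sorted hf ha hab hbc)
    have := add_le_add_of_convexOn_of_add_eq hf (u := c - (b - a)) (v := c + (b - a)) (x := c)
      (y := c) (by linarith) (by linarith) (by ring)
    linarith
  rcases le_total x y with hxy | hxy <;> rcases le_total y z with hyz | hyz <;>
    rcases le_total x z with hxz | hxz
  · exact key hx hxy hyz
  · exact key hx hxy hyz
  · rw [symIntegrand_swap, symIntegrand_rotate]
    exact key hx hxz hyz
  · rw [symIntegrand_rotate, symIntegrand_rotate]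
    exact key hz hxz hxy
  · rw [symIntegrand_swap]
    exact key hy hxy hxz
  · rw [symIntegrand_rotate]
    exact key hy hyz hxz
  · rw [symIntegrand_swap, symIntegrand_rotate, symIntegrand_rotate]
    exact key hz hyz hxy
  · rw [symIntegrand_swap, symIntegrand_rotate, symIntegrand_rotate]
    exact key hz hyz hxy

/-! ### Cubic test functions -/

/-- The convex decreasing profile `(1 - ω / r)₊³`. -/
def cubic (r ω : ℝ) : ℝ := max 0 (1 - ω / r) ^ 3

lemma cubic_nonneg (r ω : ℝ) : 0 ≤ cubic r ω := by
  unfold cubic; positivity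

lemma continuous_cubic (r : ℝ) : Continuous (cubic r) := by
  unfold cubic; fun_prop

lemma convexOn_cubic (r : ℝ) : ConvexOn ℝ univ (cubic r) := by
  refine ConvexOn.pow ?_ (fun x _ => le_max_left _ _) 3
  refine (convexOn_const 0 convex_univ).sup ⟨convex_univ, fun x _ y _ a b _ _ hab => ?_⟩
  obtain rfl : b = 1 - a := by linarith
  simp only [smul_eq_mul]
  exact le_of_eq (by ring)

lemma cubic_le_one {r ω : ℝ} (hr : 0 < r) (hω : 0 ≤ ω) : cubic r ω ≤ 1 := by
  have : 0 ≤ ω / r := by positivity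
  exact pow_le_one₀ (le_max_left _ _) (max_le zero_le_one (by linarith))

lemma cubic_eq_zero {r ω : ℝ} (hr : 0 < r) (hω : r ≤ ω) : cubic r ω = 0 := by
  have : 1 ≤ ω / r := (one_le_div hr).mpr hω
  simp [cubic, max_eq_left (show 1 - ω / r ≤ 0 by linarith)]

lemma cubic_mono {r s ω : ℝ} (hr : 0 < r) (hrs : r ≤ s) (hω : 0 ≤ ω) : cubic r ω ≤ cubic s ω := by
  unfold cubic
  have : ω / s ≤ ω / r := div_le_div_of_nonneg_left hω hr hrs
  gcongr

lemma one_eighth_le_cubic {r ω : ℝ} (hr : 0 < r) (hω : ω ≤ r / 2) : 1 / 8 ≤ cubic r ω := by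
  have : ω / r ≤ 1 / 2 := by rw [div_le_iff₀ hr]; linarith
  have h : (1 / 2 : ℝ) ≤ max 0 (1 - ω / r) := le_max_of_le_right (by linarith)
  calc (1 / 8 : ℝ) = (1 / 2) ^ 3 := by norm_num
    _ ≤ _ := by unfold cubic; gcongr

lemma abs_cubic_sub_le {r : ℝ} (hr : 0 < r) (x y : ℝ) (hx : 0 ≤ x) (hy : 0 ≤ y) :
    |cubic r x - cubic r y| ≤ 3 / r * |x - y| := by
  set p := max 0 (1 - x / r) with hp
  set q := max 0 (1 - y / r) with hq
  have hx' : 0 ≤ x / r := by positivity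
  have hy' : 0 ≤ y / r := by positivity
  have p0 : 0 ≤ p := le_max_left _ _
  have q0 : 0 ≤ q := le_max_left _ _
  have p1 : p ≤ 1 := max_le zero_le_one (by linarith)
  have q1 : q ≤ 1 := max_le zero_le_one (by linarith)
  have hpq : |p - q| ≤ |x - y| / r := by
    have h := abs_max_sub_max_le_abs (1 - x / r) (1 - y / r) 0
    rw [max_comm _ (0 : ℝ), max_comm _ (0 : ℝ)] at h
    refine h.trans (le_of_eq ?_)
    rw [show 1 - x / r - (1 - y / r) = (y - x) / r by ring, abs_div, abs_of_pos hr,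
      abs_sub_comm]
  have e : cubic r x - cubic r y = (p - q) * (p ^ 2 + p * q + q ^ 2) := by
    simp only [cubic, ← hp, ← hq]; ring
  have h3 : p ^ 2 + p * q + q ^ 2 ≤ 3 := by nlinarith
  rw [e, abs_mul, abs_of_nonneg (by positivity : 0 ≤ p ^ 2 + p * q + q ^ 2)]
  calc _ ≤ |x - y| / r * 3 := by gcongr
    _ = _ := by ring

/-- With `x = 1 - c/r` and `k = h/r`, the right side is `(x + k)³ - 2x³` if `x ≤ k` and `6xk²` if `k
≤ x`. -/
lemma cube_le_second_difference_cubic {r c h : ℝ} (hr : 0 < r) (hc : c ≤ r) (hh : 0 ≤ h) :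
    (h / r) ^ 3 ≤ cubic r (c + h) + cubic r (c - h) - 2 * cubic r c := by
  set x := 1 - c / r with hx
  set k := h / r with hk
  have hx0 : 0 ≤ x := by
    have := (div_le_one hr).mpr hc
    linarith
  have hk0 : 0 ≤ k := by positivity
  have e1 : 1 - (c + h) / r = x - k := by rw [hx, hk]; ring
  have e2 : 1 - (c - h) / r = x + k := by rw [hx, hk]; ring
  simp only [cubic, e1, e2, ← hx]
  rw [max_eq_right hx0, max_eq_right (by linarith : 0 ≤ x + k)]
  rcases le_total x k with hxk | hxk
  · rw [max_eq_left (by linarith)]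
    have : x * x * x ≤ x * x * k := by gcongr
    have : 0 ≤ x * x * k := by positivity
    have : 0 ≤ x * k * k := by positivity
    nlinarith
  · rw [max_eq_right (by linarith)]
    have : k * k * k ≤ x * k * k := by gcongr
    have : 0 ≤ k * k * k := by positivity
    nlinarith

lemma le_symIntegrand_cubic {r x y z : ℝ} (hr : 0 < r) (hx : x ∈ Icc 0 (r / 16))
    (hy : y ∈ Ioc (r / 4) r) (hz : z ∈ Ioc (r / 4) r) :
    1 / (512 * r) ≤ symIntegrand (cubic r) x y z := by
  have key : ∀ {b c : ℝ}, b ∈ Ioc (r / 4) r → c ∈ Ioc (r / 4) r → b ≤ c →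
      1 / (512 * r) ≤ symIntegrand (cubic r) x b c := by
    intro b c hb hc hbc
    have hb0 : 0 < b := by linarith [hb.1]
    have hc0 : 0 < c := by linarith [hc.1]
    have hxb : r / 8 ≤ b - x := by linarith [hb.1, hx.2]
    refine le_trans ?_ (le_symIntegrand_of_sorted (convexOn_cubic r) hx.1 (by linarith) hbc)
    have h1 : 1 / r ≤ 1 / √(b * c) := by
      have hs : 0 < √(b * c) := Real.sqrt_pos.mpr (by positivity)
      gcongr
      rw [Real.sqrt_le_left hr.le]
      nlinarith [hb.2, hc.2]
    -- The step of the second difference is at least `r/8`, whence `512 = 8³`.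
    have h2 : (1 / 8 : ℝ) ≤ (b - x) / r := by rw [le_div_iff₀ hr]; linarith
    calc 1 / (512 * r) = 1 / r * (1 / 8) ^ 3 := by field_simp; norm_num
      _ ≤ 1 / √(b * c) * ((b - x) / r) ^ 3 := by gcongr
      _ ≤ _ := by
          gcongr
          exact cube_le_second_difference_cubic hr hc.2 (by linarith)
  rcases le_total y z with h | h
  · exact key hy hz h
  · rw [symIntegrand_swap, symIntegrand_rotate]
    exact key hz hy h

/-! ### Regularity of the cubic profile -/

lemma hasDerivAt_max_zero_pow (n : ℕ) (x : ℝ) :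
    HasDerivAt (fun u : ℝ => max 0 u ^ (n + 2)) ((n + 2) * max 0 x ^ (n + 1)) x := by
  rcases lt_trichotomy x 0 with hx | rfl | hx
  · rw [max_eq_left hx.le]
    have : (fun u : ℝ => max 0 u ^ (n + 2)) =ᶠ[nhds x] fun _ => 0 := by
      filter_upwards [Iio_mem_nhds hx] with u hu
      simp [max_eq_left (le_of_lt (show u < 0 from hu))]
    simpa using (hasDerivAt_const x (0 : ℝ)).congr_of_eventuallyEq this
  · rw [max_self, zero_pow (Nat.succ_ne_zero n), mul_zero, hasDerivAt_iff_isLittleO_nhds_zero]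
    simp only [zero_add, max_self, smul_zero, sub_zero]
    have h1 : (fun h : ℝ => max 0 h ^ (n + 2)) =O[nhds 0] fun h => h ^ (n + 2) := by
      refine Asymptotics.IsBigO.of_bound 1 (Filter.Eventually.of_forall fun h => ?_)
      rw [one_mul, norm_pow, norm_pow]
      gcongr
      rw [Real.norm_eq_abs, Real.norm_eq_abs, abs_of_nonneg (le_max_left _ _)]
      exact max_le (abs_nonneg _) (le_abs_self _)
    have h2 : (fun h : ℝ => h ^ (n + 2)) =o[nhds 0] fun h => h := by
      simpa using Asymptotics.isLittleO_pow_pow (𝕜 := ℝ) (show 1 < n + 2 by omega)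
    simpa using h1.trans_isLittleO h2
  · rw [max_eq_right hx.le]
    have : (fun u : ℝ => max 0 u ^ (n + 2)) =ᶠ[nhds x] fun u => u ^ (n + 2) := by
      filter_upwards [Ioi_mem_nhds hx] with u hu
      rw [max_eq_right (le_of_lt (show 0 < u from hu))]
    have h := (hasDerivAt_pow (n + 2) x).congr_of_eventuallyEq this
    simpa using h

/-- Three is the smallest integer power for which the truncation is `C²`, as test functions must be.
-/
lemma contDiff_two_max_zero_cube : ContDiff ℝ 2 fun u : ℝ => max 0 u ^ 3 := by
  have d3 : deriv (fun u : ℝ => max 0 u ^ 3) = fun u => 3 * max 0 u ^ 2 := by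
    ext x
    rw [(hasDerivAt_max_zero_pow 1 x).deriv]
    norm_num
  have d2 : deriv (fun u : ℝ => 3 * max 0 u ^ 2) = fun u => 3 * (2 * max 0 u) := by
    ext x
    rw [((hasDerivAt_max_zero_pow 0 x).const_mul 3).deriv]
    norm_num
  rw [show (2 : WithTop ℕ∞) = 1 + 1 by norm_num, contDiff_succ_iff_deriv, d3]
  refine ⟨fun x => (hasDerivAt_max_zero_pow 1 x).differentiableAt, by simp, ?_⟩
  rw [contDiff_one_iff_deriv, d2]
  exact ⟨fun x => ((hasDerivAt_max_zero_pow 0 x).const_mul 3).differentiableAt, by fun_prop⟩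

/-- The profile `cubic r` is the restriction to `[0, ∞)` of a `C²` function with compact
support. -/
lemma exists_contDiff_eq_cubic {r : ℝ} (hr : 0 < r) : ∃ φ : ℝ → ℝ, ContDiff ℝ 2 φ ∧
    HasCompactSupport φ ∧ ∀ ω, 0 ≤ ω → φ ω = cubic r ω := by
  -- The profile grows at `-∞`; the bump cuts it off there and equals `1` on `[-r, r]`, which
  -- contains the part of the support in `[0, ∞)`.
  let χ : ContDiffBump (0 : ℝ) := ⟨r, 2 * r, hr, by linarith⟩
  refine ⟨fun ω => cubic r ω * χ ω, ?_, ?_, fun ω hω => ?_⟩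
  · refine ContDiff.mul ?_ χ.contDiff
    exact contDiff_two_max_zero_cube.comp (contDiff_const.sub (contDiff_id.div_const r))
  · exact χ.hasCompactSupport.mul_left
  · rcases le_total ω r with h | h
    · dsimp only
      rw [χ.one_of_mem_closedBall, mul_one]
      simpa [abs_of_nonneg hω] using h
    · simp [cubic_eq_zero hr h]

/-! ### Measures in the class `MemMRho` -/

lemma measure_Icc_le_rhoNorm {ρ R : ℝ} (hR : 1 < R) (μ : Measure ℝ) :
    μ (Icc (R / 2) R) ≤ ENNReal.ofReal ((1 + R) ^ ρ * R) * rhoNorm ρ μ := by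
  have hR0 : 0 < R := by linarith
  have hp : 0 < (1 + R) ^ ρ := Real.rpow_pos_of_pos (by linarith) ρ
  have h1 : ENNReal.ofReal (1 / (1 + R) ^ ρ * (1 / R)) * μ (Icc (R / 2) R) ≤ rhoNorm ρ μ :=
    (le_iSup₂ (f := fun (R : ℝ) (_ : R ∈ Ioi (1 : ℝ)) =>
      ENNReal.ofReal (1 / (1 + R) ^ ρ * (1 / R)) * μ (Icc (R / 2) R)) R hR).trans le_self_add
  have h2 : ENNReal.ofReal ((1 + R) ^ ρ * R) * ENNReal.ofReal (1 / (1 + R) ^ ρ * (1 / R)) = 1 := by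
    rw [← ENNReal.ofReal_mul (by positivity), ← ENNReal.ofReal_one]
    congr 1
    field_simp
  calc μ (Icc (R / 2) R) = ENNReal.ofReal ((1 + R) ^ ρ * R) *
        (ENNReal.ofReal (1 / (1 + R) ^ ρ * (1 / R)) * μ (Icc (R / 2) R)) := by
          rw [← mul_assoc, h2, one_mul]
    _ ≤ _ := by gcongr

/-- The dyadic shell ending at `2^(k+1)` has mass at most a constant times `2^((ρ+1)(k+1))`, which
is summable because `ρ < -1`. -/
lemma MemMRho.isFiniteMeasure {ρ : ℝ} (hρ : ρ < -1) {μ : Measure ℝ} (h : MemMRho ρ μ) :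
    IsFiniteMeasure μ := by
  set q : ℝ := 2 ^ (ρ + 1) with hq
  have hq0 : 0 < q := by positivity
  have hq1 : q < 1 := Real.rpow_lt_one_of_one_lt_of_neg one_lt_two (by linarith)
  have hpow : ∀ k : ℕ, (1 + (2 : ℝ) ^ (k + 1)) ^ ρ * 2 ^ (k + 1) ≤ q ^ (k + 1) := by
    intro k
    have h2 : (0 : ℝ) < 2 ^ (k + 1) := by positivity
    calc (1 + (2 : ℝ) ^ (k + 1)) ^ ρ * 2 ^ (k + 1)
        ≤ ((2 : ℝ) ^ (k + 1)) ^ ρ * 2 ^ (k + 1) := by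
          refine mul_le_mul_of_nonneg_right ?_ h2.le
          exact Real.rpow_le_rpow_of_nonpos h2 (by linarith) (by linarith)
      _ = q ^ (k + 1) := by
          rw [hq, ← Real.rpow_natCast, ← Real.rpow_natCast, ← Real.rpow_mul zero_le_two,
            ← Real.rpow_mul zero_le_two, ← Real.rpow_add zero_lt_two]
          congr 1
          ring
  have hle : ∀ k : ℕ, μ (Icc ((2 : ℝ) ^ (k + 1) / 2) (2 ^ (k + 1)))
      ≤ ENNReal.ofReal (q ^ (k + 1)) * rhoNorm ρ μ := fun k =>
    (measure_Icc_le_rhoNorm (one_lt_pow₀ one_lt_two (Nat.succ_ne_zero k)) μ).trans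
      (by gcongr; exact hpow k)
  have hcover : (univ : Set ℝ) ⊆
      Iio 0 ∪ Icc 0 1 ∪ ⋃ k : ℕ, Icc ((2 : ℝ) ^ (k + 1) / 2) (2 ^ (k + 1)) := by
    intro x _
    rcases lt_or_ge x 0 with hx | hx
    · exact Or.inl (Or.inl hx)
    rcases le_or_gt x 1 with hx1 | hx1
    · exact Or.inl (Or.inr ⟨hx, hx1⟩)
    obtain ⟨k, hk1, hk2⟩ := exists_nat_pow_near hx1.le (one_lt_two : (1 : ℝ) < 2)
    refine Or.inr (mem_iUnion.mpr ⟨k, ?_, hk2.le⟩)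
    rw [pow_succ]
    linarith
  refine ⟨(measure_mono hcover).trans_lt ((measure_union_le _ _).trans_lt
    (ENNReal.add_lt_top.mpr ⟨(measure_union_le _ _).trans_lt (ENNReal.add_lt_top.mpr ⟨?_, ?_⟩),
      (measure_iUnion_le _).trans_lt ?_⟩))⟩
  · simp [h.1]
  · exact lt_of_le_of_lt le_add_self h.2
  · refine (ENNReal.tsum_le_tsum hle).trans_lt ?_
    rw [ENNReal.tsum_mul_right]
    refine ENNReal.mul_lt_top ?_ h.2
    rw [← ENNReal.ofReal_tsum_of_nonneg (fun _ => by positivity)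
      ((summable_nat_add_iff 1).mpr (summable_geometric_of_lt_one hq0.le hq1))]
    exact ENNReal.ofReal_lt_top

/-! ### The collision integral -/

lemma ae_nonneg {μ : Measure ℝ} (hμ : μ (Iio 0) = 0) : ∀ᵐ x ∂μ, 0 ≤ x := by
  rw [ae_iff]
  simpa [Iio_def] using hμ

lemma ae_prod_nonneg {μ : Measure ℝ} [IsFiniteMeasure μ] (hμ : μ (Iio 0) = 0) :
    ∀ᵐ p : ℝ × ℝ × ℝ ∂(μ.prod (μ.prod μ)), 0 ≤ p.1 ∧ 0 ≤ p.2.1 ∧ 0 ≤ p.2.2 := by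
  have h := ae_nonneg hμ
  have q1 : Measure.QuasiMeasurePreserving (Prod.fst : ℝ × ℝ × ℝ → ℝ) (μ.prod (μ.prod μ)) μ :=
    Measure.quasiMeasurePreserving_fst
  have q2 : Measure.QuasiMeasurePreserving (Prod.snd : ℝ × ℝ × ℝ → ℝ × ℝ) (μ.prod (μ.prod μ))
    (μ.prod μ) := Measure.quasiMeasurePreserving_snd
  filter_upwards [q1.ae h, (Measure.quasiMeasurePreserving_fst.comp q2).ae h,
    (Measure.quasiMeasurePreserving_snd.comp q2).ae h] with p h1 h2 h3
  exact ⟨h1, h2, h3⟩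

lemma collision_eq_integral (μ : Measure ℝ) (f : ℝ → ℝ) :
    collision μ f = ∫ p : ℝ × ℝ × ℝ, integrand f p.1 p.2.1 p.2.2 ∂(μ.prod (μ.prod μ)) := rfl

lemma collision_congr {μ : Measure ℝ} [IsFiniteMeasure μ] (hμ : μ (Iio 0) = 0) {f h : ℝ → ℝ}
    (hfh : ∀ x, 0 ≤ x → f x = h x) : collision μ f = collision μ h := by
  rw [collision_eq_integral, collision_eq_integral]
  refine integral_congr_ae ?_
  filter_upwards [ae_prod_nonneg hμ] with p hp
  exact integrand_congr hfh hp.1 hp.2.1 hp.2.2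

section

variable {μ : Measure ℝ} [IsFiniteMeasure μ] {f : ℝ → ℝ} {L : ℝ}

lemma integrable_integrand (hμ : μ (Iio 0) = 0) (hf : Continuous f)
    (hL : ∀ x y, 0 ≤ x → 0 ≤ y → |f x - f y| ≤ L * |x - y|) :
    Integrable (fun p : ℝ × ℝ × ℝ => integrand f p.1 p.2.1 p.2.2) (μ.prod (μ.prod μ)) := by
  refine Integrable.of_bound (measurable_integrand hf).aestronglyMeasurable (2 * L) ?_
  filter_upwards [ae_prod_nonneg hμ] with p hp
  exact abs_integrand_le hL hp.1 hp.2.1 hp.2.2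

lemma abs_collision_le (hμ : μ (Iio 0) = 0)
    (hL : ∀ x y, 0 ≤ x → 0 ≤ y → |f x - f y| ≤ L * |x - y|) :
    |collision μ f| ≤ 2 * L * (μ.real univ * (μ.real univ * μ.real univ)) := by
  have h := norm_integral_le_of_norm_le_const (μ := μ.prod (μ.prod μ))
    (f := fun p : ℝ × ℝ × ℝ => integrand f p.1 p.2.1 p.2.2) (C := 2 * L) (by
      filter_upwards [ae_prod_nonneg hμ] with p hp
      exact abs_integrand_le hL hp.1 hp.2.1 hp.2.2)
  rw [collision_eq_integral]
  refine h.trans (le_of_eq ?_)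
  rw [← univ_prod_univ, measureReal_prod_prod, ← univ_prod_univ, measureReal_prod_prod]

lemma measurePreserving_rotate :
    MeasurePreserving (fun p : ℝ × ℝ × ℝ => (p.2.1, p.2.2, p.1)) (μ.prod (μ.prod μ))
      (μ.prod (μ.prod μ)) :=
  (measurePreserving_prodAssoc μ μ μ).comp Measure.measurePreserving_swap

/-- The triple product measure is invariant under cyclic permutations, so the three terms have equal
integrals. -/
lemma integral_symIntegrand (hμ : μ (Iio 0) = 0) (hf : Continuous f)
    (hL : ∀ x y, 0 ≤ x → 0 ≤ y → |f x - f y| ≤ L * |x - y|) :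
    Integrable (fun p : ℝ × ℝ × ℝ => symIntegrand f p.1 p.2.1 p.2.2) (μ.prod (μ.prod μ)) ∧
    ∫ p : ℝ × ℝ × ℝ, symIntegrand f p.1 p.2.1 p.2.2 ∂(μ.prod (μ.prod μ))
      = 3 * collision μ f := by
  have i1 := integrable_integrand hμ hf hL
  have m1 := measurePreserving_rotate (μ := μ)
  have m2 := m1.comp m1
  have hm := (measurable_integrand hf).aestronglyMeasurable (μ := μ.prod (μ.prod μ))
  have i2 : Integrable (fun p : ℝ × ℝ × ℝ => integrand f p.2.1 p.2.2 p.1) (μ.prod (μ.prod μ)) :=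
    m1.integrable_comp_of_integrable i1
  have i3 : Integrable (fun p : ℝ × ℝ × ℝ => integrand f p.2.2 p.1 p.2.1) (μ.prod (μ.prod μ)) :=
    m2.integrable_comp_of_integrable i1
  have inv : ∀ {T : ℝ × ℝ × ℝ → ℝ × ℝ × ℝ},
      MeasurePreserving T (μ.prod (μ.prod μ)) (μ.prod (μ.prod μ)) →
      ∫ p, integrand f (T p).1 (T p).2.1 (T p).2.2 ∂(μ.prod (μ.prod μ)) = collision μ f := by
    intro T hT
    rw [collision_eq_integral]
    conv_rhs => rw [← hT.map_eq]
    rw [integral_map hT.measurable.aemeasurable (by rw [hT.map_eq]; exact hm)]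
  have e2 : ∫ p : ℝ × ℝ × ℝ, integrand f p.2.1 p.2.2 p.1 ∂(μ.prod (μ.prod μ))
      = collision μ f := inv m1
  have e3 : ∫ p : ℝ × ℝ × ℝ, integrand f p.2.2 p.1 p.2.1 ∂(μ.prod (μ.prod μ))
      = collision μ f := inv m2
  refine ⟨(i1.add i2).add i3, ?_⟩
  simp only [symIntegrand]
  rw [integral_add (by exact i1.add i2) i3, integral_add i1 i2, e2, e3, ← collision_eq_integral]
  ring

lemma collision_nonneg (hμ : μ (Iio 0) = 0) (hf : Continuous f) (hc : ConvexOn ℝ univ f)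
    (hL : ∀ x y, 0 ≤ x → 0 ≤ y → |f x - f y| ≤ L * |x - y|) : 0 ≤ collision μ f := by
  have h : 0 ≤ ∫ p : ℝ × ℝ × ℝ, symIntegrand f p.1 p.2.1 p.2.2 ∂(μ.prod (μ.prod μ)) := by
    refine integral_nonneg_of_ae ?_
    filter_upwards [ae_prod_nonneg hμ] with p hp
    exact symIntegrand_nonneg hc hp.1 hp.2.1 hp.2.2
  rw [(integral_symIntegrand hμ hf hL).2] at h
  linarith

/-- Triples made of a small frequency and of two frequencies of size comparable to `r` push mass
towards the origin. -/
lemma le_collision_cubic (hμ : μ (Iio 0) = 0) {r : ℝ} (hr : 0 < r) :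
    1 / (1536 * r) * (μ.real (Icc 0 (r / 16)) * μ.real (Ioc (r / 4) r) ^ 2)
      ≤ collision μ (cubic r) := by
  obtain ⟨hi, he⟩ := integral_symIntegrand hμ (continuous_cubic r) (abs_cubic_sub_le hr)
  set s : Set (ℝ × ℝ × ℝ) := Icc 0 (r / 16) ×ˢ (Ioc (r / 4) r ×ˢ Ioc (r / 4) r) with hs
  have hsm : MeasurableSet s := by measurability
  have h1 : ∫ p in s, 1 / (512 * r) ∂(μ.prod (μ.prod μ))
      ≤ ∫ p in s, symIntegrand (cubic r) p.1 p.2.1 p.2.2 ∂(μ.prod (μ.prod μ)) :=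
    setIntegral_mono_on (integrable_const _) hi.integrableOn hsm
      fun p hp => le_symIntegrand_cubic hr hp.1 hp.2.1 hp.2.2
  have h2 : ∫ p in s, symIntegrand (cubic r) p.1 p.2.1 p.2.2 ∂(μ.prod (μ.prod μ))
      ≤ ∫ p : ℝ × ℝ × ℝ, symIntegrand (cubic r) p.1 p.2.1 p.2.2 ∂(μ.prod (μ.prod μ)) := by
    refine setIntegral_le_integral hi ?_
    filter_upwards [ae_prod_nonneg hμ] with p hp
    exact symIntegrand_nonneg (convexOn_cubic r) hp.1 hp.2.1 hp.2.2
  rw [he] at h2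
  rw [setIntegral_const, hs, measureReal_prod_prod, measureReal_prod_prod, smul_eq_mul] at h1
  -- `1536 = 3 * 512`, the `3` coming from the symmetrisation.
  have e : 1 / (1536 * r) * (μ.real (Icc 0 (r / 16)) * μ.real (Ioc (r / 4) r) ^ 2)
      = μ.real (Icc 0 (r / 16)) * (μ.real (Ioc (r / 4) r) * μ.real (Ioc (r / 4) r))
        * (1 / (512 * r)) / 3 := by
    field_simp
    ring
  rw [e]
  linarith

/-! ### The truncated mass -/

/-- The smoothed mass of `μ` in `[0, r]`. -/
def truncMass (μ : Measure ℝ) (r : ℝ) : ℝ := ∫ ω, cubic r ω ∂μ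

lemma integrable_cubic (hμ : μ (Iio 0) = 0) {r : ℝ} (hr : 0 < r) : Integrable (cubic r) μ := by
  refine Integrable.of_bound (continuous_cubic r).aestronglyMeasurable 1 ?_
  filter_upwards [ae_nonneg hμ] with x hx
  rw [Real.norm_of_nonneg (cubic_nonneg r x)]
  exact cubic_le_one hr hx

lemma truncMass_nonneg (μ : Measure ℝ) (r : ℝ) : 0 ≤ truncMass μ r :=
  integral_nonneg (cubic_nonneg r)

lemma truncMass_mono (hμ : μ (Iio 0) = 0) {r s : ℝ} (hr : 0 < r) (hrs : r ≤ s) :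
    truncMass μ r ≤ truncMass μ s := by
  refine integral_mono_ae (integrable_cubic hμ hr) (integrable_cubic hμ (hr.trans_le hrs)) ?_
  filter_upwards [ae_nonneg hμ] with x hx
  exact cubic_mono hr hrs hx

lemma truncMass_le_measureReal (hμ : μ (Iio 0) = 0) {r : ℝ} (hr : 0 < r) :
    truncMass μ r ≤ μ.real (Icc 0 r) := by
  rw [← integral_indicator_one measurableSet_Icc]
  refine integral_mono_ae (integrable_cubic hμ hr)
    ((integrable_const 1).indicator measurableSet_Icc) ?_
  filter_upwards [ae_nonneg hμ] with x hx
  by_cases hxr : x ≤ r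
  · rw [indicator_of_mem (show x ∈ Icc 0 r from ⟨hx, hxr⟩)]
    exact cubic_le_one hr hx
  · rw [cubic_eq_zero hr (le_of_not_ge hxr)]
    exact indicator_nonneg (fun _ _ => zero_le_one) x

lemma measureReal_le_truncMass (hμ : μ (Iio 0) = 0) {r : ℝ} (hr : 0 < r) :
    μ.real (Icc 0 (r / 2)) ≤ 8 * truncMass μ r := by
  rw [← integral_indicator_one measurableSet_Icc, truncMass, ← integral_const_mul]
  refine integral_mono ((integrable_const 1).indicator measurableSet_Icc)
    ((integrable_cubic hμ hr).const_mul 8) fun x => ?_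
  by_cases hxr : x ∈ Icc 0 (r / 2)
  · rw [indicator_of_mem hxr]
    have := one_eighth_le_cubic hr hxr.2
    simp only [Pi.one_apply]
    linarith
  · rw [indicator_of_notMem hxr]
    have := cubic_nonneg r x
    positivity

/-- Continuity from above of the finite measure `μ` along `[0, u n]`, which shrinks to `{0}`. The
absence of an atom enters the argument only here. -/
lemma tendsto_truncMass_zero (hμ : μ (Iio 0) = 0) {u : ℕ → ℝ} (hu0 : ∀ n, 0 < u n)
    (hu : Antitone u) (hlim : Filter.Tendsto u Filter.atTop (nhds 0)) (h0 : μ {0} = 0) :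
    Filter.Tendsto (fun n => truncMass μ (u n)) Filter.atTop (nhds 0) := by
  have h1 : Filter.Tendsto (fun n => μ.real (Icc 0 (u n))) Filter.atTop (nhds 0) := by
    have h := tendsto_measure_iInter_atTop (μ := μ) (s := fun n => Icc 0 (u n))
      (fun _ => measurableSet_Icc.nullMeasurableSet)
      (fun m n hmn => Icc_subset_Icc_right (hu hmn)) ⟨0, measure_ne_top _ _⟩
    have he : ⋂ n, Icc 0 (u n) = ({0} : Set ℝ) := by
      ext x
      simp only [mem_iInter, mem_Icc, mem_singleton_iff]
      refine ⟨fun hx => le_antisymm (ge_of_tendsto' hlim fun n => (hx n).2) (hx 0).1, ?_⟩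
      rintro rfl n
      exact ⟨le_rfl, (hu0 n).le⟩
    rw [he, h0] at h
    have := (ENNReal.tendsto_toReal ENNReal.zero_ne_top).comp h
    simpa [Function.comp_def, Measure.real] using this
  exact squeeze_zero (fun n => truncMass_nonneg _ _)
    (fun n => truncMass_le_measureReal hμ (hu0 n)) h1

lemma measureReal_Icc_le_sum (μ : Measure ℝ) [IsFiniteMeasure μ] {u : ℕ → ℝ} (K : ℕ) :
    μ.real (Icc 0 (u 0)) ≤ ∑ k ∈ Finset.range K, μ.real (Ioc (u (k + 1)) (u k))
      + μ.real (Icc 0 (u K)) := by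
  induction K with
  | zero => simp
  | succ K ih =>
    have h : μ.real (Icc 0 (u K)) ≤ μ.real (Ioc (u (K + 1)) (u K))
        + μ.real (Icc 0 (u (K + 1))) := by
      refine (measureReal_mono ?_).trans (measureReal_union_le _ _)
      intro x hx
      rcases le_or_gt x (u (K + 1)) with h | h
      · exact Or.inr ⟨hx.1, h⟩
      · exact Or.inl ⟨h, hx.2⟩
    rw [Finset.sum_range_succ]
    linarith

end

/-! ### Measurability in time -/

/-- A continuous approximation from below of the indicator function of `(a, b)`. -/
def tent (a b : ℝ) (n : ℕ) (x : ℝ) : ℝ := min 1 (n * max 0 (min (x - a) (b - x)))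

lemma continuous_tent (a b : ℝ) (n : ℕ) : Continuous (tent a b n) := by
  unfold tent; fun_prop

lemma tent_eq_zero {a b : ℝ} {n : ℕ} {x : ℝ} (hx : x ∉ Ioo a b) : tent a b n x = 0 := by
  have h : min (x - a) (b - x) ≤ 0 := by
    by_contra! h
    exact hx ⟨by linarith [(lt_min_iff.mp h).1], by linarith [(lt_min_iff.mp h).2]⟩
  simp [tent, max_eq_left h]

lemma hasCompactSupport_tent (a b : ℝ) (n : ℕ) : HasCompactSupport (tent a b n) :=
  HasCompactSupport.intro isCompact_Icc fun _ hx =>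
    tent_eq_zero fun h => hx (Ioo_subset_Icc_self h)

lemma abs_tent_le_one (a b : ℝ) (n : ℕ) (x : ℝ) : |tent a b n x| ≤ 1 := by
  have : 0 ≤ tent a b n x := by unfold tent; positivity
  rw [abs_of_nonneg this]
  exact min_le_left _ _

lemma tendsto_tent (a b x : ℝ) : Filter.Tendsto (fun n => tent a b n x) Filter.atTop
    (nhds ((Ioo a b).indicator 1 x)) := by
  by_cases hx : x ∈ Ioo a b
  · rw [indicator_of_mem hx]
    have hm : 0 < max 0 (min (x - a) (b - x)) :=
      lt_max_of_lt_right (lt_min (by linarith [hx.1]) (by linarith [hx.2]))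
    refine tendsto_const_nhds.congr' ?_
    obtain ⟨N, hN⟩ := exists_nat_gt (1 / max 0 (min (x - a) (b - x)))
    filter_upwards [Filter.eventually_ge_atTop N] with n hn
    have : (N : ℝ) ≤ n := by exact_mod_cast hn
    rw [tent, min_eq_left, Pi.one_apply]
    rw [div_lt_iff₀ hm] at hN
    nlinarith
  · rw [indicator_of_notMem hx]
    simp [tent_eq_zero hx]

/-- A family of finite measures which is measurable when tested against continuous compactly
supported functions, and whose total mass is measurable, is measurable. -/
lemma measurable_of_measurable_integral {μ : ℝ → Measure ℝ} [∀ t, IsFiniteMeasure (μ t)]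
    (h : ∀ ψ : ℝ → ℝ, Continuous ψ → HasCompactSupport ψ → Measurable fun t => ∫ x, ψ x ∂(μ t))
    (huniv : Measurable fun t => μ t univ) : Measurable μ := by
  refine Measurable.measure_of_isPiSystem
    (BorelSpace.measurable_eq.trans Real.borel_eq_generateFrom_Ioo_rat)
    Real.isPiSystem_Ioo_rat ?_ huniv
  intro s hs
  obtain ⟨a, b, rfl⟩ : ∃ a b : ℝ, s = Ioo a b := by
    simp only [mem_iUnion, mem_singleton_iff] at hs
    obtain ⟨a, b, -, rfl⟩ := hs
    exact ⟨a, b, rfl⟩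
  have hreal : Measurable fun t => (μ t).real (Ioo a b) := by
    refine measurable_of_tendsto_metrizable
      (fun n => h _ (continuous_tent a b n) (hasCompactSupport_tent a b n))
      (tendsto_pi_nhds.mpr fun t => ?_)
    rw [← integral_indicator_one measurableSet_Ioo]
    exact tendsto_integral_of_dominated_convergence (fun _ => 1)
      (fun n => (continuous_tent a b n).aestronglyMeasurable) (integrable_const 1)
      (fun n => Filter.Eventually.of_forall (abs_tent_le_one a b n))
      (Filter.Eventually.of_forall (tendsto_tent a b))
  convert hreal.ennreal_ofReal using 2 with t
  rw [ofReal_measureReal]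

/-- The family `g`, extended by `0` to nonpositive times. -/
def positiveTime (g : ℝ → Measure ℝ) (t : ℝ) : Measure ℝ := if 0 < t then g t else 0

namespace IsWeakSolution

variable {ρ : ℝ} {f₀ : Measure ℝ} {g : ℝ → Measure ℝ}

lemma isFiniteMeasure (hg : IsWeakSolution ρ f₀ g) (hρ : ρ < -1) {t : ℝ} (ht : 0 < t) :
    IsFiniteMeasure (g t) :=
  (hg.mem t ht.le).isFiniteMeasure hρ

lemma isFiniteMeasure_sqrtMul (hg : IsWeakSolution ρ f₀ g) (hρ : ρ < -1) :
    IsFiniteMeasure (sqrtMul f₀) := by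
  have := hg.isFiniteMeasure hρ one_pos
  exact ⟨by rw [← hg.mass 1 one_pos]; exact measure_lt_top _ _⟩

lemma isFiniteMeasure_positiveTime (hg : IsWeakSolution ρ f₀ g) (hρ : ρ < -1) (t : ℝ) :
    IsFiniteMeasure (positiveTime g t) := by
  unfold positiveTime
  split_ifs with ht
  · exact hg.isFiniteMeasure hρ ht
  · infer_instance

lemma measurable_positiveTime (hg : IsWeakSolution ρ f₀ g) (hρ : ρ < -1) :
    Measurable (positiveTime g) := by
  have := hg.isFiniteMeasure_positiveTime hρ
  refine measurable_of_measurable_integral (fun ψ hψ hψc => ?_) ?_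
  · have e : (fun t => ∫ x, ψ x ∂(positiveTime g t))
        = (Ioi (0 : ℝ)).piecewise (fun t => ∫ x, ψ x ∂(g t)) (fun _ => 0) := by
      ext t
      by_cases ht : 0 < t <;> simp [positiveTime, piecewise, ht]
    rw [e]
    exact ((hg.cont ψ hψ hψc).mono Ioi_subset_Ici_self).measurable_piecewise
      continuousOn_const measurableSet_Ioi
  · have e : (fun t => positiveTime g t univ)
        = (Ioi (0 : ℝ)).piecewise (fun _ => sqrtMul f₀ univ) (fun _ => 0) := by
      ext t
      by_cases ht : 0 < t
      · simp [positiveTime, piecewise, ht, hg.mass t ht]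
      · simp [positiveTime, piecewise, ht]
    rw [e]
    exact measurable_const.piecewise measurableSet_Ioi measurable_const

lemma stronglyMeasurable_collision (hg : IsWeakSolution ρ f₀ g) (hρ : ρ < -1) {f : ℝ → ℝ}
    (hf : Continuous f) : StronglyMeasurable fun t => collision (positiveTime g t) f := by
  have := hg.isFiniteMeasure_sqrtMul hρ
  -- As a finite transition kernel in time, the solution yields a measurable triple product. Times
  -- `t ≤ 0` are removed since mass conservation is only given for `t > 0`.
  let κ : ProbabilityTheory.Kernel ℝ ℝ := ⟨positiveTime g, hg.measurable_positiveTime hρ⟩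
  have hκ : ProbabilityTheory.IsFiniteKernel κ := by
    refine ⟨⟨sqrtMul f₀ univ, measure_lt_top _ _, fun t => ?_⟩⟩
    change positiveTime g t univ ≤ _
    unfold positiveTime
    split_ifs with ht
    · exact (hg.mass t ht).le
    · simp
  have h := StronglyMeasurable.integral_kernel
    (κ := ProbabilityTheory.Kernel.prod κ (ProbabilityTheory.Kernel.prod κ κ))
    (measurable_integrand hf).stronglyMeasurable
  simp only [ProbabilityTheory.Kernel.prod_apply] at h
  exact h

lemma intervalIntegrable_collision (hg : IsWeakSolution ρ f₀ g) (hρ : ρ < -1) {f : ℝ → ℝ}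
    (hf : Continuous f) {L : ℝ} (hL : ∀ x y, 0 ≤ x → 0 ≤ y → |f x - f y| ≤ L * |x - y|)
    {s t : ℝ} (hs : 0 ≤ s) (ht : 0 ≤ t) :
    IntervalIntegrable (fun t => collision (g t) f) volume s t := by
  rw [intervalIntegrable_iff]
  have hpos : ∀ τ ∈ uIoc s t, 0 < τ := fun τ hτ => (le_min hs ht).trans_lt hτ.1
  set m := (sqrtMul f₀).real univ
  have hi : IntegrableOn (fun τ => collision (positiveTime g τ) f) (uIoc s t) volume := by
    refine Measure.integrableOn_of_bounded (M := 2 * L * (m * (m * m))) (by simp [uIoc])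
      (hg.stronglyMeasurable_collision hρ hf).aestronglyMeasurable ?_
    refine ae_restrict_of_forall_mem measurableSet_uIoc fun τ hτ => ?_
    have := hg.isFiniteMeasure hρ (hpos τ hτ)
    have h := abs_collision_le (μ := g τ) (hg.mem τ (hpos τ hτ).le).1 hL
    have e : (g τ).real univ = m := by simp only [Measure.real, hg.mass τ (hpos τ hτ), m]
    rw [e] at h
    simpa [positiveTime, hpos τ hτ] using h
  refine hi.congr_fun (fun τ hτ => ?_) measurableSet_uIoc
  simp [positiveTime, hpos τ hτ]

/-! ### Evolution of the truncated mass -/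

lemma sqrtMul_Iio (f : Measure ℝ) : sqrtMul f (Iio 0) = 0 := by
  rw [sqrtMul, withDensity_apply _ measurableSet_Iio]
  refine setLIntegral_eq_zero measurableSet_Iio fun x hx => ?_
  simp [Real.sqrt_eq_zero'.mpr (le_of_lt (show x < 0 from hx))]

/-- The weak formulation for a test function which does not depend on time. -/
lemma weak_of_const (hg : IsWeakSolution ρ f₀ g) {φ : ℝ → ℝ} (hφ : ContDiff ℝ 2 φ)
    (hc : HasCompactSupport φ) {T : ℝ} (hT : 0 < T) :
    (∫ ω, φ ω ∂(g T)) - ∫ ω, φ ω ∂(sqrtMul f₀) = ∫ t in (0 : ℝ)..T, collision (g t) φ := by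
  -- A cut-off in time equal to `1` near `[0, T]` makes the test function compactly supported
  -- without contributing a time derivative.
  let χ : ContDiffBump (0 : ℝ) := ⟨T + 1, T + 2, by linarith, by linarith⟩
  have hχ : ∀ t ∈ Icc 0 T, (χ : ℝ → ℝ) =ᶠ[nhds t] 1 := by
    intro t ht
    refine χ.eventuallyEq_one_of_mem_ball ?_
    simp only [Metric.mem_ball, dist_zero_right, Real.norm_eq_abs, abs_of_nonneg ht.1]
    exact lt_of_le_of_lt ht.2 (lt_add_one T)
  have hχ1 : ∀ t ∈ Icc 0 T, χ t = 1 := fun t ht => (hχ t ht).eq_of_nhds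
  have h := hg.weak (fun t ω => χ t * φ ω) ?_ ?_ T hT
  · rw [hχ1 T ⟨hT.le, le_rfl⟩, hχ1 0 ⟨le_rfl, hT.le⟩] at h
    simp only [one_mul] at h
    rw [h]
    have h1 : ∫ t in (0 : ℝ)..T, ∫ ω, deriv (fun s => χ s * φ ω) t ∂(g t) = 0 := by
      rw [intervalIntegral.integral_congr (g := fun _ => 0)]
      · simp
      · intro t ht
        rw [uIcc_of_le hT.le] at ht
        have hd : ∀ ω, deriv (fun s => χ s * φ ω) t = 0 := by
          intro ω
          have : (fun s => χ s * φ ω) =ᶠ[nhds t] fun _ => φ ω := by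
            filter_upwards [hχ t ht] with s hs
            rw [hs, Pi.one_apply, one_mul]
          rw [this.deriv_eq, deriv_const]
        simp [hd]
    rw [h1, zero_add]
    refine intervalIntegral.integral_congr fun t ht => ?_
    rw [uIcc_of_le hT.le] at ht
    simp [hχ1 t ht]
  · exact (χ.contDiff.comp contDiff_fst).mul (hφ.comp contDiff_snd)
  · refine HasCompactSupport.intro (χ.hasCompactSupport.isCompact.prod hc.isCompact) ?_
    rintro ⟨t, ω⟩ hp
    rw [mem_prod, not_and_or] at hp
    simp only [Function.uncurry]
    rcases hp with hp | hp
    · rw [image_eq_zero_of_notMem_tsupport hp, zero_mul]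
    · rw [image_eq_zero_of_notMem_tsupport hp, mul_zero]

lemma truncMass_sub_initial (hg : IsWeakSolution ρ f₀ g) (hρ : ρ < -1) {r T : ℝ} (hr : 0 < r)
    (hT : 0 < T) : truncMass (g T) r - truncMass (sqrtMul f₀) r
      = ∫ t in (0 : ℝ)..T, collision (g t) (cubic r) := by
  obtain ⟨φ, hφ, hc, he⟩ := exists_contDiff_eq_cubic hr
  have h := hg.weak_of_const hφ hc hT
  have e : ∀ {μ : Measure ℝ}, μ (Iio 0) = 0 → ∫ ω, φ ω ∂μ = truncMass μ r := by
    intro μ hμ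
    refine integral_congr_ae ?_
    filter_upwards [ae_nonneg hμ] with x hx using he x hx
  rw [e (hg.mem T hT.le).1, e (sqrtMul_Iio f₀)] at h
  rw [h]
  refine intervalIntegral.integral_congr fun t ht => ?_
  rw [uIcc_of_le hT.le] at ht
  have := (hg.mem t ht.1).isFiniteMeasure hρ
  exact collision_congr (hg.mem t ht.1).1 he

lemma truncMass_sub (hg : IsWeakSolution ρ f₀ g) (hρ : ρ < -1) {r s t : ℝ} (hr : 0 < r)
    (hs : 0 < s) (ht : 0 < t) : truncMass (g t) r - truncMass (g s) r
      = ∫ τ in s..t, collision (g τ) (cubic r) := by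
  have hi : ∀ {a b : ℝ}, 0 ≤ a → 0 ≤ b →
      IntervalIntegrable (fun τ => collision (g τ) (cubic r)) volume a b := fun ha hb =>
    hg.intervalIntegrable_collision hρ (continuous_cubic r) (abs_cubic_sub_le hr) ha hb
  rw [← intervalIntegral.integral_interval_sub_left (hi le_rfl ht.le) (hi le_rfl hs.le),
    ← hg.truncMass_sub_initial hρ hr ht, ← hg.truncMass_sub_initial hρ hr hs]
  ring

lemma collision_cubic_nonneg (hg : IsWeakSolution ρ f₀ g) (hρ : ρ < -1) {r t : ℝ} (hr : 0 < r)
    (ht : 0 ≤ t) : 0 ≤ collision (g t) (cubic r) := by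
  have := (hg.mem t ht).isFiniteMeasure hρ
  exact collision_nonneg (hg.mem t ht).1 (continuous_cubic r) (convexOn_cubic r)
    (abs_cubic_sub_le hr)

/-- The initial data enter only through the weak formulation, not through `g 0`; hence this
comparison is separate from the monotonicity between positive times. -/
lemma truncMass_initial_le (hg : IsWeakSolution ρ f₀ g) (hρ : ρ < -1) {r t : ℝ} (hr : 0 < r)
    (ht : 0 < t) : truncMass (sqrtMul f₀) r ≤ truncMass (g t) r := by
  rw [← sub_nonneg, hg.truncMass_sub_initial hρ hr ht]
  exact intervalIntegral.integral_nonneg ht.le fun τ hτ => hg.collision_cubic_nonneg hρ hr hτ.1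

lemma truncMass_mono_time (hg : IsWeakSolution ρ f₀ g) (hρ : ρ < -1) {r s t : ℝ} (hr : 0 < r)
    (hs : 0 < s) (hst : s ≤ t) : truncMass (g s) r ≤ truncMass (g t) r := by
  rw [← sub_nonneg, hg.truncMass_sub hρ hr hs (hs.trans_le hst)]
  exact intervalIntegral.integral_nonneg hst fun τ hτ =>
    hg.collision_cubic_nonneg hρ hr (hs.le.trans hτ.1)

end IsWeakSolution

/-! ### Doubling of the truncated mass -/

lemma sqrt_div_four_pow {r : ℝ} (k : ℕ) : √(r / 4 ^ k) = √r / 2 ^ k := by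
  rw [show (4 : ℝ) ^ k = (2 ^ k) ^ 2 by rw [← pow_mul, mul_comm, pow_mul]; norm_num,
    Real.sqrt_div' _ (by positivity), Real.sqrt_sq (by positivity)]

lemma sum_range_pow_le {q : ℝ} (h0 : 0 ≤ q) (h1 : q < 1) (K : ℕ) :
    ∑ k ∈ Finset.range K, q ^ k ≤ (1 - q)⁻¹ :=
  sum_le_hasSum _ (fun _ _ => by positivity) (hasSum_geometric_of_lt_one h0 h1)

/-- This is `le_collision_cubic` solved for the shell mass, with `μ([0, r/16]) ≥ N √r / 4` and `6144
= 4 * 1536`. -/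
lemma sq_measureReal_le_collision {μ : Measure ℝ} [IsFiniteMeasure μ] (hμ : μ (Iio 0) = 0)
    {N r : ℝ} (hN : 0 < N) (hr : 0 < r) (h : N * √(r / 16) ≤ truncMass μ (r / 16)) :
    μ.real (Ioc (r / 4) r) ^ 2 ≤ 6144 * √r / N * collision μ (cubic r) := by
  have h1 : N * (√r / 4) ≤ μ.real (Icc 0 (r / 16)) := by
    have e : √(r / 16) = √r / 4 := by
      rw [show (16 : ℝ) = 4 ^ 2 by norm_num, sqrt_div_four_pow]
      norm_num
    rw [e] at h
    exact h.trans (truncMass_le_measureReal hμ (by positivity))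
  have hs : 0 < √r := Real.sqrt_pos.mpr hr
  have h2 := le_collision_cubic hμ hr
  set n := μ.real (Ioc (r / 4) r)
  have h3 : 1 / (1536 * r) * (N * (√r / 4) * n ^ 2) ≤ collision μ (cubic r) :=
    le_trans (by gcongr) h2
  calc n ^ 2 = 6144 * √r / N * (1 / (1536 * r) * (N * (√r / 4) * n ^ 2)) := by
        field_simp
        rw [Real.sq_sqrt hr.le]
        ring
    _ ≤ _ := by gcongr

/-- If the mass of `μ` near the origin is at least that of `N / √ω`, and does not concentrate
beyond the scale `r / 4 ^ K`, then the collision rates of the scales `r / 4 ^ k` are bounded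
below on average. -/
lemma le_sum_collision {μ : Measure ℝ} [IsFiniteMeasure μ] (hμ : μ (Iio 0) = 0)
    {N P r : ℝ} (hN : 0 < N) (hP : 0 < P) (hr : 0 < r) {K : ℕ}
    (hlow : ∀ k : ℕ, N * √(r / 4 ^ k / 16) ≤ truncMass μ (r / 4 ^ k / 16))
    (hPr : P ≤ truncMass μ r) (hK : 8 * truncMass μ (2 * (r / 4 ^ K)) ≤ P / 2) :
    P / 4 ≤ 24576 * √r / (N * P) *
      ∑ k ∈ Finset.range K, (2 / 3) ^ k * collision μ (cubic (r / 4 ^ k)) := by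
  set n : ℕ → ℝ := fun k => μ.real (Ioc (r / 4 ^ (k + 1)) (r / 4 ^ k)) with hn
  have hs : 0 < √r := Real.sqrt_pos.mpr hr
  have h1 : P / 2 ≤ ∑ k ∈ Finset.range K, n k := by
    have a := measureReal_Icc_le_sum μ (u := fun k => r / 4 ^ k) K
    have b := measureReal_le_truncMass hμ (r := 2 * (r / 4 ^ K)) (by positivity)
    rw [mul_div_cancel_left₀ _ two_ne_zero] at b
    have c := truncMass_le_measureReal hμ hr
    simp only [pow_zero, div_one] at a
    linarith
  have h2 : ∀ k, n k ≤ P / 16 * (3 / 4) ^ k +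
      24576 * √r / (N * P) * ((2 / 3) ^ k * collision μ (cubic (r / 4 ^ k))) := by
    intro k
    have hsq := sq_measureReal_le_collision hμ hN (r := r / 4 ^ k) (by positivity) (hlow k)
    rw [show r / 4 ^ k / 4 = r / 4 ^ (k + 1) by rw [pow_succ]; field_simp, sqrt_div_four_pow]
      at hsq
    set c := collision μ (cubic (r / 4 ^ k))
    -- Weights for Young's inequality: the terms `l / 2` sum to at most `P/4`, half of the shell
    -- mass, while `2⁻ᵏ` from `√(r / 4ᵏ)` divided by `(3/4)ᵏ` leaves the summable factor `(2/3)ᵏ`.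
    set l := P / 8 * (3 / 4 : ℝ) ^ k with hl
    have hl0 : 0 < l := by positivity
    have am : n k ≤ l / 2 + n k ^ 2 / (2 * l) := by
      have : 0 ≤ (n k - l) ^ 2 / (2 * l) := by positivity
      have e : (n k - l) ^ 2 / (2 * l) = l / 2 + n k ^ 2 / (2 * l) - n k := by
        field_simp
        ring
      linarith
    calc n k ≤ l / 2 + n k ^ 2 / (2 * l) := am
      _ ≤ l / 2 + (6144 * (√r / 2 ^ k) / N * c) / (2 * l) := by gcongr
      _ = _ := by
          rw [hl, div_pow, div_pow, show (4 : ℝ) ^ k = 2 ^ k * 2 ^ k by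
            rw [← mul_pow]; norm_num]
          field_simp
          ring
  have h3 : ∑ k ∈ Finset.range K, n k ≤ P / 16 * 4 + 24576 * √r / (N * P) *
      ∑ k ∈ Finset.range K, (2 / 3) ^ k * collision μ (cubic (r / 4 ^ k)) := by
    refine (Finset.sum_le_sum fun k _ => h2 k).trans ?_
    rw [Finset.sum_add_distrib, ← Finset.mul_sum, ← Finset.mul_sum]
    gcongr
    exact (sum_range_pow_le (by norm_num) (by norm_num) K).trans (by norm_num)
  linarith

namespace IsWeakSolution

variable {ρ : ℝ} {f₀ : Measure ℝ} {g : ℝ → Measure ℝ}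

lemma exists_truncMass_le (hg : IsWeakSolution ρ f₀ g) (hρ : ρ < -1) {T : ℝ} (hT : 0 < T)
    (h0 : g T {0} = 0) {r ε : ℝ} (hr : 0 < r) (hε : 0 < ε) :
    ∃ K : ℕ, truncMass (g T) (2 * (r / 4 ^ K)) ≤ ε := by
  have := hg.isFiniteMeasure hρ hT
  have hlim : Filter.Tendsto (fun K : ℕ => 2 * (r / 4 ^ K)) Filter.atTop (nhds 0) := by
    have := (tendsto_pow_atTop_nhds_zero_of_lt_one (r := (1 / 4 : ℝ)) (by norm_num)
      (by norm_num)).const_mul (2 * r)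
    rw [mul_zero] at this
    refine this.congr fun K => ?_
    rw [one_div_pow]
    ring
  have hanti : Antitone fun K : ℕ => 2 * (r / (4 : ℝ) ^ K) := by
    intro m n hmn
    dsimp only
    gcongr
    norm_num
  have h := tendsto_truncMass_zero (hg.mem T hT.le).1 (fun K => by positivity) hanti hlim h0
  exact (h.eventually_le_const hε).exists

/-- As long as no mass sits at the origin, a lower bound `N √r` for the truncated mass at all
small scales doubles within a time of order `N⁻²`. -/
lemma two_mul_le_truncMass (hg : IsWeakSolution ρ f₀ g) (hρ : ρ < -1) {B N s t T : ℝ}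
    (hN : 0 < N) (hs : 0 < s) (hst : t = s + 600000 / N ^ 2) (htT : t ≤ T)
    (h0 : g T {0} = 0) (hlow : ∀ r ∈ Ioc 0 B, N * √r ≤ truncMass (g s) r) :
    ∀ r ∈ Ioc 0 B, 2 * N * √r ≤ truncMass (g t) r := by
  intro r hr
  have hr0 : 0 < r := hr.1
  have hlt : s < t := by rw [hst]; linarith [show 0 < 600000 / N ^ 2 by positivity]
  have ht : 0 < t := hs.trans hlt
  have hsq : 0 < √r := Real.sqrt_pos.mpr hr0
  set P := truncMass (g s) r
  have hNP : N * √r ≤ P := hlow r hr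
  have hP : 0 < P := lt_of_lt_of_le (by positivity) hNP
  have hrk : ∀ k : ℕ, r / 4 ^ k ≤ r := fun k => div_le_self hr0.le (one_le_pow₀ (by norm_num))
  -- `K` is fixed at the last time `T`; by monotonicity it then serves all `τ` in `[s, t]`. The
  -- choice `P/16` gives `8 * (P/16) = P/2`.
  obtain ⟨K, hK⟩ := hg.exists_truncMass_le hρ (ht.trans_le htT) h0 hr0
    (show 0 < P / 16 by positivity)
  set D := 24576 * √r / (N * P) with hD
  have hD0 : 0 < D := by positivity
  have hpt : ∀ τ ∈ Icc s t, P / 4 ≤ D *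
      ∑ k ∈ Finset.range K, (2 / 3) ^ k * collision (g τ) (cubic (r / 4 ^ k)) := by
    intro τ hτ
    have hτ0 : 0 < τ := hs.trans_le hτ.1
    have := hg.isFiniteMeasure hρ hτ0
    refine le_sum_collision (hg.mem τ hτ0.le).1 hN hP hr0 (fun k => ?_)
      (hg.truncMass_mono_time hρ hr0 hs hτ.1) ?_
    · have hk : 0 < r / 4 ^ k / 16 := by positivity
      have hkB : r / 4 ^ k / 16 ≤ B :=
        (div_le_self (by positivity) (by norm_num)).trans ((hrk k).trans hr.2)
      exact (hlow _ ⟨hk, hkB⟩).trans (hg.truncMass_mono_time hρ hk hs hτ.1)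
    · have := hg.truncMass_mono_time hρ (r := 2 * (r / 4 ^ K)) (by positivity) hτ0
        (hτ.2.trans htT)
      linarith
  have hint : ∀ k : ℕ, IntervalIntegrable
      (fun τ => (2 / 3 : ℝ) ^ k * collision (g τ) (cubic (r / 4 ^ k))) volume s t := fun k =>
    (hg.intervalIntegrable_collision hρ (continuous_cubic _)
      (abs_cubic_sub_le (by positivity)) hs.le ht.le).const_mul _
  have hsum : IntervalIntegrable (fun τ => ∑ k ∈ Finset.range K,
      (2 / 3 : ℝ) ^ k * collision (g τ) (cubic (r / 4 ^ k))) volume s t := by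
    have h := IntervalIntegrable.sum (Finset.range K) (fun k _ => hint k)
    simpa only [Finset.sum_fn] using h
  -- Integrating in time turns each collision rate into an increment of truncated mass.
  have h1 : (t - s) * (P / 4) ≤ D * ∑ k ∈ Finset.range K,
      (2 / 3 : ℝ) ^ k * (truncMass (g t) (r / 4 ^ k) - truncMass (g s) (r / 4 ^ k)) := by
    have h := intervalIntegral.integral_mono_on hlt.le
      (intervalIntegrable_const (c := P / 4)) (hsum.const_mul D) hpt
    rw [intervalIntegral.integral_const, intervalIntegral.integral_const_mul,
      intervalIntegral.integral_finsetSum (fun k _ => hint k), smul_eq_mul] at h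
    refine h.trans (le_of_eq ?_)
    congr 1
    refine Finset.sum_congr rfl fun k _ => ?_
    rw [intervalIntegral.integral_const_mul, hg.truncMass_sub hρ (by positivity) hs ht]
  have h2 : ∑ k ∈ Finset.range K,
      (2 / 3 : ℝ) ^ k * (truncMass (g t) (r / 4 ^ k) - truncMass (g s) (r / 4 ^ k))
      ≤ 3 * truncMass (g t) r := by
    have := hg.isFiniteMeasure hρ ht
    calc _ ≤ ∑ k ∈ Finset.range K, (2 / 3 : ℝ) ^ k * truncMass (g t) r := by
          refine Finset.sum_le_sum fun k _ => ?_
          gcongr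
          have a := truncMass_mono (hg.mem t ht.le).1 (r := r / 4 ^ k) (by positivity) (hrk k)
          have b := truncMass_nonneg (g s) (r / 4 ^ k)
          linarith
      _ ≤ _ := by
          rw [← Finset.sum_mul]
          gcongr
          · exact truncMass_nonneg _ _
          · exact (sum_range_pow_le (by norm_num) (by norm_num) K).trans (by norm_num)
  set Q := truncMass (g t) r
  have h3 : 600000 / N ^ 2 * (P / 4) ≤ D * (3 * Q) := by
    have : t - s = 600000 / N ^ 2 := by linarith
    rw [this] at h1
    exact h1.trans (by gcongr)
  have h4 : 150000 * P ^ 2 ≤ 73728 * (N * √r) * Q := by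
    have e1 : 600000 / N ^ 2 * (P / 4) * (N ^ 2 * P) = 150000 * P ^ 2 := by field_simp; norm_num
    have e2 : D * (3 * Q) * (N ^ 2 * P) = 73728 * (N * √r) * Q := by
      rw [hD]; field_simp; ring
    rw [← e1, ← e2]
    gcongr
  have hQ : 0 ≤ Q := truncMass_nonneg _ _
  -- The waiting time `600000 / N²` is chosen so that `150000 / 73728 > 2`.
  have h5 : 150000 * P ≤ 73728 * Q := by
    have : 73728 * (N * √r) * Q ≤ 73728 * P * Q := by gcongr
    have h6 : P * (150000 * P) ≤ P * (73728 * Q) := by linarith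
    exact le_of_mul_le_mul_left h6 hP
  linarith

/-- The waiting times `600000 / (2ⁱ N)²`, `i < j`, form a geometric series of ratio `1/4` with sum
`(800000 / N²)(1 - 4⁻ʲ)`. -/
lemma two_pow_mul_le_truncMass (hg : IsWeakSolution ρ f₀ g) (hρ : ρ < -1) {B N T : ℝ}
    (hN : 0 < N) (h0 : g T {0} = 0)
    (hlow : ∀ t, 0 < t → ∀ r ∈ Ioc 0 B, N * √r ≤ truncMass (g t) r) (j : ℕ) :
    ∀ t, 800000 / N ^ 2 * (1 - 1 / 4 ^ j) < t → t ≤ T →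
      ∀ r ∈ Ioc 0 B, 2 ^ j * N * √r ≤ truncMass (g t) r := by
  induction j with
  | zero =>
    intro t ht _ r hr
    simpa using hlow t (by simpa using ht) r hr
  | succ j ih =>
    intro t ht htT r hr
    set s := t - 600000 / (2 ^ j * N) ^ 2 with hs
    have e : 800000 / N ^ 2 * (1 - 1 / 4 ^ (j + 1))
        = 800000 / N ^ 2 * (1 - 1 / 4 ^ j) + 600000 / (2 ^ j * N) ^ 2 := by
      rw [mul_pow, ← pow_mul, mul_comm j 2, pow_mul, pow_succ]
      norm_num
      field_simp
      ring
    have hsj : 800000 / N ^ 2 * (1 - 1 / 4 ^ j) < s := by linarith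
    have hs0 : 0 < s := by
      refine lt_of_le_of_lt (mul_nonneg (by positivity) (sub_nonneg.mpr ?_)) hsj
      rw [div_le_one (by positivity)]
      exact one_le_pow₀ (by norm_num)
    have hst : s ≤ t := by
      have : 0 ≤ 600000 / (2 ^ j * N) ^ 2 := by positivity
      linarith
    have h := hg.two_mul_le_truncMass hρ (B := B) (N := 2 ^ j * N) (s := s) (t := t)
      (by positivity) hs0 (by rw [hs]; ring) htT h0 (ih s hsj (hst.trans htT)) r hr
    calc (2 : ℝ) ^ (j + 1) * N * √r = 2 * (2 ^ j * N) * √r := by rw [pow_succ]; ring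
      _ ≤ _ := h

/-- A weak solution whose truncated mass is at least `N √r` at all small scales has a condensate
after a time of order `N⁻²`. -/
lemma measure_singleton_zero_pos (hg : IsWeakSolution ρ f₀ g) (hρ : ρ < -1) {B N T : ℝ}
    (hB : 0 < B) (hN : 0 < N)
    (hlow : ∀ t, 0 < t → ∀ r ∈ Ioc 0 B, N * √r ≤ truncMass (g t) r)
    (hT : 800000 / N ^ 2 < T) : 0 < g T {0} := by
  by_contra hcon
  have h0 : g T {0} = 0 := nonpos_iff_eq_zero.mp (not_lt.mp hcon)
  have hB' : 0 < N * √B := mul_pos hN (Real.sqrt_pos.mpr hB)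
  -- This many doublings exceed the truncated mass at scale `B`.
  obtain ⟨j, hj⟩ := pow_unbounded_of_one_lt (truncMass (g T) B / (N * √B))
    (one_lt_two : (1 : ℝ) < 2)
  have hlt : 800000 / N ^ 2 * (1 - 1 / 4 ^ j) < T := by
    refine lt_of_le_of_lt (mul_le_of_le_one_right (by positivity) ?_) hT
    have : (0 : ℝ) ≤ 1 / 4 ^ j := by positivity
    linarith
  have h := hg.two_pow_mul_le_truncMass hρ hN h0 hlow j T hlt le_rfl B ⟨hB, le_rfl⟩
  rw [div_lt_iff₀ hB'] at hj
  linarith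

end IsWeakSolution

/-! ### The initial data -/

/-- The density `A / √ω` is at least `A / √s` on `(0, s)`; this loses only a factor `2`. -/
lemma le_sqrtMul_initialData {A B s : ℝ} (hA : 0 < A) (hs : 0 < s) (hsB : s ≤ B)
    (g₀ : Measure ℝ) : ENNReal.ofReal (A * √s) ≤ sqrtMul (initialData A B g₀) (Ioo 0 s) := by
  have hm : Measurable fun ω : ℝ => ENNReal.ofReal √ω := by fun_prop
  have hm' : Measurable fun ω : ℝ => ENNReal.ofReal (A * ω⁻¹) := by fun_prop
  have hle : (rayleighJeans A).restrict (Ioo 0 s) ≤ (initialData A B g₀).restrict (Ioo 0 s) := by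
    calc (rayleighJeans A).restrict (Ioo 0 s)
        = ((rayleighJeans A).restrict (Ioo 0 B)).restrict (Ioo 0 s) := by
          rw [Measure.restrict_restrict measurableSet_Ioo,
            inter_eq_left.mpr (Ioo_subset_Ioo_right hsB)]
      _ ≤ _ := Measure.restrict_mono subset_rfl (Measure.le_add_right le_rfl)
  have hrj : (rayleighJeans A).restrict (Ioo 0 s)
      = (volume.restrict (Ioo 0 s)).withDensity fun ω => ENNReal.ofReal (A * ω⁻¹) := by
    rw [rayleighJeans, restrict_withDensity measurableSet_Ioo,
      Measure.restrict_restrict measurableSet_Ioo,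
      inter_eq_left.mpr Ioo_subset_Ioi_self]
  have hss : 0 < √s := Real.sqrt_pos.mpr hs
  calc ENNReal.ofReal (A * √s) = ∫⁻ _ in Ioo 0 s, ENNReal.ofReal (A / √s) := by
        rw [setLIntegral_const, Real.volume_Ioo, sub_zero, ← ENNReal.ofReal_mul (by positivity)]
        congr 1
        rw [div_mul_eq_mul_div, mul_div_assoc, Real.div_sqrt]
    _ ≤ ∫⁻ ω in Ioo 0 s, ENNReal.ofReal (A * ω⁻¹) * ENNReal.ofReal √ω := by
        refine setLIntegral_mono (hm'.mul hm) fun ω hω => ?_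
        have hω0 : 0 < ω := hω.1
        have hωs : 0 < √ω := Real.sqrt_pos.mpr hω0
        rw [← ENNReal.ofReal_mul (by positivity)]
        refine ENNReal.ofReal_le_ofReal ?_
        have e : A * ω⁻¹ * √ω = A / √ω := by
          have := Real.sq_sqrt hω0.le
          field_simp
          linarith
        rw [e]
        have := Real.sqrt_le_sqrt hω.2.le
        gcongr
    _ = ∫⁻ ω, ENNReal.ofReal √ω ∂((rayleighJeans A).restrict (Ioo 0 s)) := by
        rw [hrj, lintegral_withDensity_eq_lintegral_mul _ hm' hm]
        rfl
    _ ≤ ∫⁻ ω in Ioo 0 s, ENNReal.ofReal √ω ∂(initialData A B g₀) := lintegral_mono' hle le_rfl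
    _ = _ := by rw [sqrtMul, withDensity_apply _ measurableSet_Ioo]

/-- Half of `A √r` comes from the scale `r/4`, and the factor `1/8` is the lower bound of the
profile on `[0, r/2]`. -/
lemma le_truncMass_initialData {A B r : ℝ} (hA : 0 < A) (hr : 0 < r) (hrB : r ≤ B)
    (g₀ : Measure ℝ) [IsFiniteMeasure (sqrtMul (initialData A B g₀))] :
    A / 16 * √r ≤ truncMass (sqrtMul (initialData A B g₀)) r := by
  set ν := sqrtMul (initialData A B g₀)
  have h1 : A * √(r / 4) ≤ ν.real (Ioo 0 (r / 4)) := by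
    have h := le_sqrtMul_initialData hA (show 0 < r / 4 by positivity)
      (by linarith : r / 4 ≤ B) g₀
    exact (ENNReal.ofReal_le_iff_le_toReal (measure_ne_top _ _)).mp h
  have h2 : ν.real (Ioo 0 (r / 4)) ≤ ν.real (Icc 0 (r / 2)) :=
    measureReal_mono fun x hx => ⟨hx.1.le, by linarith [hx.2]⟩
  have h3 := measureReal_le_truncMass (μ := ν) (IsWeakSolution.sqrtMul_Iio _) hr
  have e : √(r / 4) = √r / 2 := by simpa using sqrt_div_four_pow (r := r) 1
  rw [e] at h1
  linarith

end WaveKinetic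

end

theorem theorem1 :
    ∃ C : ℝ, 0 < C ∧ ∀ A B ρ : ℝ, 0 < A → 0 < B → ρ < -1 →
      ∀ g₀ : MeasureTheory.Measure ℝ, WaveKinetic.MemMRho ρ g₀ →
        ∀ g : ℝ → MeasureTheory.Measure ℝ,
          WaveKinetic.IsWeakSolution ρ (WaveKinetic.initialData A B g₀) g →
            ∀ t : ℝ, C * A ^ (-2 : ℤ) < t → 0 < g t {0} := by
  -- The constant is `800000 / N²` with `N = A/16`.
  refine ⟨800000 * 16 ^ 2, by norm_num, fun A B ρ hA hB hρ g₀ _ g hg t ht => ?_⟩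
  have := hg.isFiniteMeasure_sqrtMul hρ
  refine hg.measure_singleton_zero_pos hρ hB (N := A / 16) (by positivity)
    (fun s hs r hr => ?_) ?_
  · exact (WaveKinetic.le_truncMass_initialData hA hr.1 hr.2 g₀).trans
      (hg.truncMass_initial_le hρ hr.1 hs)
  · convert ht using 1
    rw [zpow_neg, zpow_ofNat, div_pow, div_div_eq_mul_div, div_eq_mul_inv]
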